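/- There is a constant $c>0$ such that the following holds for every even integer $n\ge 2$. Let $G=(V,E)$ be the $n\times n$ grid: $V=\{(i,j)\in\mathbb Z^2:1\le i,j\le n\}$ with nearest-neighbour edges. Let $J=(J_e)_{e\in E}$ be i.i.d. standard Gaussian couplings, and let $\sigma=\sigma(J)\in\{-1,+1\}^V$ be a ground state, i.e. a maximizer of $$H(\sigma)=\sum_{e=\{x,y\}\in E}J_e\,\sigma_x\sigma_y ,$$ which is almost surely unique up to a global sign flip. For $w,z\in V$ the relative spin $\sigma_w\sigma_z$ is thus an almost surely well-defined function of $J$. Let $h_k$ ($k\ge 0$) be the Hermite polynomials, normalized to be orthonormal in $L^2$ of the standard Gaussian law, and for $\mathbf k=(k_e)_{e\in E}\in\{0,1,2,\dots\}^E$ put $h_{\mathbf k}(J)=\prod_{e\in E}h_{k_e}(J_e)$. Let $u=(1,n/2)$ and $v=(n,n/2)$, let $\alpha_{\mathbf k}=\mathbb E[\sigma_u\sigma_v\,h_{\mathbf k}(J)]$, and define the spectral measure of $\sigma_u\sigma_v$ by $\mu(\mathbf k)=\alpha_{\mathbf k}^2$ and, for $S\subseteq E$, $$\mu(S)=\sum_{\mathbf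 k:\ \{e\in E:\,k_e\ge 1\}=S}\mu(\mathbf k).$$ Let $\mathcal L=\{\{(k,n/2),(k+1,n/2)\}:1\le k<n\}\subseteq E$ be the horizontal line of edges joining $u$ and $v$. Then $$\mu(\mathcal L)\le \exp(-cn).$$ -/

import Mathlib

namespace EdwardsAnderson

section Model

variable {V : Type*} (G : SimpleGraph V)

/-- Coupling constants: one real number `J e` for each edge `e` of `G`. -/
abbrev Couplings : Type _ := G.edgeSet → ℝ

/-- Spin configurations `σ ∈ {-1, +1}^V` (`ℤˣ` is the two-element group `{1, -1}`). -/
abbrev Spins (V : Type*) : Type _ := V → ℤˣ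

/-- The product `σ_x σ_y` of the spins at the two ends of an edge `e = {x, y}`. -/
def bond (σ : Spins V) (e : Sym2 V) : ℤˣ :=
  Sym2.lift ⟨fun x y => σ x * σ y, fun x y => mul_comm (σ x) (σ y)⟩ e

/-- The Hamiltonian `H(σ) = ∑_{e = {x, y}} J_e σ_x σ_y`. -/
noncomputable def hamiltonian [Fintype G.edgeSet] (J : Couplings G) (σ : Spins V) : ℝ :=
  ∑ e : G.edgeSet, J e * ((bond σ (e : Sym2 V) : ℤ) : ℝ)

/-- A ground state is a spin configuration that maximizes the Hamiltonian. -/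
def IsGroundState [Fintype G.edgeSet] (J : Couplings G) (σ : Spins V) : Prop :=
  ∀ τ : Spins V, hamiltonian G J τ ≤ hamiltonian G J σ

theorem exists_isGroundState [Finite V] [Fintype G.edgeSet] (J : Couplings G) :
    ∃ σ : Spins V, IsGroundState G J σ :=
  Finite.exists_max (hamiltonian G J)

/-- A ground state for the couplings `J`.  On a connected graph the choice is immaterial:
for almost every `J` the ground state is unique up to a global sign flip. -/
noncomputable def groundState [Finite V] [Fintype G.edgeSet] (J : Couplings G) : Spins V :=
  Classical.choose (exists_isGroundState G J)

/-- The relative spin `σ_u σ_v` of the ground state, as a function of the couplings. -/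
noncomputable def relativeSpin [Finite V] [Fintype G.edgeSet] (u v : V) (J : Couplings G) : ℝ :=
  ((groundState G J u * groundState G J v : ℤˣ) : ℤ)

/-- The law of i.i.d. standard Gaussian couplings. -/
noncomputable def couplingLaw [Fintype G.edgeSet] : MeasureTheory.Measure (Couplings G) :=
  MeasureTheory.Measure.pi fun _ => ProbabilityTheory.gaussianReal 0 1

/-- The Hermite polynomial of degree `k`, normalized to have unit norm in `L²` of the standard
Gaussian (`Polynomial.hermite k` is the monic one, of squared norm `k!`). -/
noncomputable def hermiteNormalized (k : ℕ) (x : ℝ) : ℝ :=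
  Polynomial.aeval x (Polynomial.hermite k) / Real.sqrt (k.factorial : ℝ)

/-- The tensor product `h_k(J) = ∏_e h_{k_e}(J_e)` for a multi-index `k ∈ ℕ^E`. -/
noncomputable def hermiteTensor [Fintype G.edgeSet] (k : G.edgeSet → ℕ) (J : Couplings G) : ℝ :=
  ∏ e : G.edgeSet, hermiteNormalized (k e) (J e)

/-- The Fourier-Hermite coefficient `α_k = 𝔼[σ_u σ_v h_k(J)]`. -/
noncomputable def fourierCoeff [Finite V] [Fintype G.edgeSet] (u v : V) (k : G.edgeSet → ℕ) : ℝ :=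
  ∫ J, relativeSpin G u v J * hermiteTensor G k J ∂(couplingLaw G)

/-- The support `E_k = {e : k_e ≥ 1}` of a multi-index. -/
def indexSupport (k : G.edgeSet → ℕ) : Set G.edgeSet :=
  {e | 1 ≤ k e}

/-- The spectral measure of `σ_u σ_v` on `ℕ^E`, with mass `α_k ^ 2` at each multi-index `k`. -/
noncomputable def spectralMeasure [Finite V] [Fintype G.edgeSet] (u v : V) :
    MeasureTheory.Measure (G.edgeSet → ℕ) :=
  MeasureTheory.Measure.sum fun k =>
    ENNReal.ofReal (fourierCoeff G u v k ^ 2) • MeasureTheory.Measure.dirac k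

/-- `μ(S) = ∑_{k : E_k = S} μ(k)`: the spectral mass of the multi-indices whose support is
exactly the set of edges `S`. -/
noncomputable def spectralMass [Finite V] [Fintype G.edgeSet] (u v : V) (S : Set G.edgeSet) :
    ENNReal :=
  spectralMeasure G u v {k | indexSupport G k = S}

end Model

section Grid

/-- The `n × n` grid with nearest-neighbour edges. -/
def grid (n : ℕ) : SimpleGraph (Fin n × Fin n) :=
  (SimpleGraph.pathGraph n).boxProd (SimpleGraph.pathGraph n)

noncomputable instance gridEdgeFintype (n : ℕ) : Fintype (grid n).edgeSet :=
  Fintype.ofFinite _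

/-- The grid vertex whose coordinates are `(i, j)` when counted from `1` to `n`. -/
def vertex (n i j : ℕ) (hi : 1 ≤ i ∧ i ≤ n) (hj : 1 ≤ j ∧ j ≤ n) : Fin n × Fin n :=
  (⟨i - 1, by omega⟩, ⟨j - 1, by omega⟩)

/-- The horizontal line of edges `{(k, j), (k + 1, j)}`, `1 ≤ k < n`, at height `j`. -/
def horizontalLine (n j : ℕ) (hj : 1 ≤ j ∧ j ≤ n) : Set (grid n).edgeSet :=
  {e | ∃ (k : ℕ) (hk : 1 ≤ k ∧ k < n),
    (e : Sym2 (Fin n × Fin n)) =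
      s(vertex n k j ⟨hk.1, hk.2.le⟩ hj, vertex n (k + 1) j ⟨by omega, hk.2⟩ hj)}

theorem half_mem {n : ℕ} (hpos : 0 < n) (heven : Even n) : 1 ≤ n / 2 ∧ n / 2 ≤ n := by
  obtain ⟨m, hm⟩ := heven
  omega

end Grid

end EdwardsAnderson

/-!
Let `A` be an event that is invariant under changing the signs of couplings, on which changing the
signs of some couplings off `𝓛` negates `σ_u σ_v`. If every edge of `k` with `k_e ≥ 1` lies on `𝓛`,
then `h_k` is unaffected by these signs, so `A` contributes nothing to `𝔼[σ_u σ_v h_k]`.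

Such events live on plaquettes with a side on `𝓛`. If the three other sides are dominant at one of
their ends, then they are satisfied by every ground state, so that negating the coupling on the base
does not change the ground state at all. Follow this by the gauge transformation that
negates all spins to the right of the base: it negates `σ_u σ_v`, and on `𝓛` it changes the sign
of the base only, which undoes the first change there.

About `n / 3` such plaquettes fit along `𝓛` with independent events of a probability bounded away
from zero. All coefficients supported on `𝓛` are therefore those of `σ_u σ_v` restricted to the
event that none of them occurs, and by Bessel's inequality the sum of their squares is at most
the probability of this event.
-/

namespace EdwardsAnderson

open MeasureTheory ProbabilityTheory Polynomial
open scoped ENNReal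

section Hermite

theorem integrable_eval_gaussianReal (q : ℝ[X]) :
    Integrable (fun x => q.eval x) (gaussianReal 0 1) := by
  induction q using Polynomial.induction_on' with
  | add p q hp hq =>
    simp only [eval_add]
    exact hp.add hq
  | monomial n a =>
    simp only [eval_monomial]
    have hpow := (memLp_id_gaussianReal (μ := 0) (v := 1) n).integrable_norm_pow'
    exact (hpow.mono' (by fun_prop) (.of_forall fun x => (norm_pow x n).le)).const_mul a

theorem integrable_eval_mul_gaussianPDFReal (q : ℝ[X]) :
    Integrable (fun x => q.eval x * gaussianPDFReal 0 1 x) := by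
  have h := integrable_eval_gaussianReal q
  rw [gaussianReal_of_var_ne_zero _ one_ne_zero,
    integrable_withDensity_iff (measurable_gaussianPDF _ _)
      (.of_forall fun _ => gaussianPDF_lt_top)] at h
  simpa only [toReal_gaussianPDF] using h

theorem hasDerivAt_gaussianPDFReal_standard (x : ℝ) :
    HasDerivAt (gaussianPDFReal 0 1) (-x * gaussianPDFReal 0 1 x) x := by
  have hexp : HasDerivAt (fun y : ℝ => Real.exp (-y ^ 2 / 2)) (Real.exp (-x ^ 2 / 2) * -x) x := by
    have hexponent : HasDerivAt (fun y : ℝ => -y ^ 2 / 2) (-x) x :=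
      ((hasDerivAt_pow 2 x).fun_neg.div_const 2).congr_deriv (by norm_num [neg_div])
    exact hexponent.exp
  have hpdf : gaussianPDFReal 0 1 = fun y => (√(2 * Real.pi))⁻¹ * Real.exp (-y ^ 2 / 2) := by
    simp [gaussianPDFReal_def]
  rw [hpdf]
  exact (hexp.const_mul _).congr_deriv (by ring)

/-- The expectation of `q Z` for a standard Gaussian variable `Z`, as a linear functional of the
polynomial `q`. -/
noncomputable def gaussianExpectation : ℝ[X] →ₗ[ℝ] ℝ where
  toFun q := ∫ x, q.eval x ∂gaussianReal 0 1
  map_add' p q := by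
    simp only [eval_add]
    exact integral_add (integrable_eval_gaussianReal p) (integrable_eval_gaussianReal q)
  map_smul' a q := by simp only [eval_smul, smul_eq_mul, integral_const_mul, RingHom.id_apply]

theorem gaussianExpectation_apply (q : ℝ[X]) :
    gaussianExpectation q = ∫ x, q.eval x ∂gaussianReal 0 1 := rfl

theorem gaussianExpectation_C (a : ℝ) : gaussianExpectation (C a) = a := by
  simp [gaussianExpectation_apply]

theorem gaussianExpectation_X_mul (q : ℝ[X]) :
    gaussianExpectation (X * q) = gaussianExpectation (derivative q) := by
  have hparts := integral_mul_deriv_eq_deriv_mul_of_integrable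
    (u := fun x => q.eval x) (v := gaussianPDFReal 0 1)
    (fun x _ => q.hasDerivAt x) (fun x _ => hasDerivAt_gaussianPDFReal_standard x)
    (by
      refine (integrable_eval_mul_gaussianPDFReal (-X * q)).congr (.of_forall fun x => ?_)
      simp only [eval_mul, eval_neg, eval_X, Pi.mul_apply]
      ring)
    (integrable_eval_mul_gaussianPDFReal _) (integrable_eval_mul_gaussianPDFReal q)
  rw [gaussianExpectation_apply, gaussianExpectation_apply,
    integral_gaussianReal_eq_integral_smul one_ne_zero,
    integral_gaussianReal_eq_integral_smul one_ne_zero]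
  calc ∫ x, gaussianPDFReal 0 1 x • (X * q).eval x
      = -∫ x, q.eval x * (-x * gaussianPDFReal 0 1 x) := by
        rw [← integral_neg]
        congr! 2 with x
        simp only [smul_eq_mul, eval_mul, eval_X]
        ring
    _ = ∫ x, gaussianPDFReal 0 1 x • (derivative q).eval x := by
        rw [hparts, neg_neg]
        simp only [smul_eq_mul, mul_comm]

/-- The (monic) Hermite polynomial of degree `n`, with real coefficients. -/
noncomputable def hermiteReal (n : ℕ) : ℝ[X] := (hermite n).map (algebraMap ℤ ℝ)

theorem hermiteReal_succ (n : ℕ) :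
    hermiteReal (n + 1) = X * hermiteReal n - derivative (hermiteReal n) := by
  simp only [hermiteReal, hermite_succ, Polynomial.map_sub, Polynomial.map_mul, map_X,
    derivative_map]

theorem natDegree_hermiteReal_le (n : ℕ) : (hermiteReal n).natDegree ≤ n :=
  natDegree_map_le.trans natDegree_hermite.le

theorem iterate_derivative_hermiteReal_self (n : ℕ) :
    derivative^[n] (hermiteReal n) = C (n.factorial : ℝ) := by
  have hdeg : (derivative^[n] (hermiteReal n)).natDegree = 0 := by
    have := natDegree_iterate_derivative (hermiteReal n) n
    have := natDegree_hermiteReal_le n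
    omega
  rw [eq_C_of_natDegree_eq_zero hdeg, coeff_iterate_derivative, zero_add, hermiteReal, coeff_map,
    coeff_hermite_self, map_one, nsmul_one, Nat.descFactorial_self]

theorem gaussianExpectation_hermiteReal_mul (n : ℕ) (q : ℝ[X]) :
    gaussianExpectation (hermiteReal n * q) = gaussianExpectation (derivative^[n] q) := by
  induction n generalizing q with
  | zero => simp [hermiteReal]
  | succ n ih =>
    calc gaussianExpectation (hermiteReal (n + 1) * q)
        = gaussianExpectation (X * (hermiteReal n * q))
            - gaussianExpectation (derivative (hermiteReal n) * q) := by
          rw [hermiteReal_succ, sub_mul, mul_assoc, map_sub]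
      _ = gaussianExpectation (hermiteReal n * derivative q) := by
          rw [gaussianExpectation_X_mul, derivative_mul, map_add, add_sub_cancel_left]
      _ = gaussianExpectation (derivative^[n + 1] q) := by
          rw [ih, Function.iterate_succ_apply]

theorem gaussianExpectation_hermiteReal_mul_of_lt {m n : ℕ} (h : m < n) :
    gaussianExpectation (hermiteReal n * hermiteReal m) = 0 := by
  rw [gaussianExpectation_hermiteReal_mul,
    iterate_derivative_eq_zero ((natDegree_hermiteReal_le m).trans_lt h), map_zero]

theorem gaussianExpectation_hermiteReal_mul_hermiteReal (m n : ℕ) :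
    gaussianExpectation (hermiteReal m * hermiteReal n) =
      if m = n then (n.factorial : ℝ) else 0 := by
  rcases lt_trichotomy m n with h | rfl | h
  · rw [mul_comm, gaussianExpectation_hermiteReal_mul_of_lt h, if_neg h.ne]
  · rw [gaussianExpectation_hermiteReal_mul, iterate_derivative_hermiteReal_self,
      gaussianExpectation_C, if_pos rfl]
  · rw [gaussianExpectation_hermiteReal_mul_of_lt h, if_neg h.ne']

theorem hermiteNormalized_zero (x : ℝ) : hermiteNormalized 0 x = 1 := by
  simp [hermiteNormalized]

theorem measurable_hermiteNormalized (k : ℕ) : Measurable (hermiteNormalized k) :=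
  (hermite k).continuous_aeval.measurable.div_const _

theorem hermiteNormalized_mul (m n : ℕ) (x : ℝ) :
    hermiteNormalized m x * hermiteNormalized n x =
      (√(m.factorial) * √(n.factorial))⁻¹ * (hermiteReal m * hermiteReal n).eval x := by
  simp only [hermiteNormalized, hermiteReal, eval_mul, eval_map_algebraMap]
  field_simp

theorem integrable_hermiteNormalized_mul (m n : ℕ) :
    Integrable (fun x => hermiteNormalized m x * hermiteNormalized n x) (gaussianReal 0 1) := by
  simp only [hermiteNormalized_mul]
  exact (integrable_eval_gaussianReal _).const_mul _

theorem integral_hermiteNormalized_mul (m n : ℕ) :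
    ∫ x, hermiteNormalized m x * hermiteNormalized n x ∂gaussianReal 0 1 =
      if m = n then 1 else 0 := by
  simp only [hermiteNormalized_mul]
  rw [integral_const_mul, ← gaussianExpectation_apply,
    gaussianExpectation_hermiteReal_mul_hermiteReal]
  split_ifs with h
  · rw [h, Real.mul_self_sqrt (by positivity), inv_mul_cancel₀ (by positivity)]
  · rw [mul_zero]

end Hermite

section HermiteTensor

variable {V : Type*} (G : SimpleGraph V) [Fintype G.edgeSet]

instance isProbabilityMeasure_couplingLaw : IsProbabilityMeasure (couplingLaw G) := by
  unfold couplingLaw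
  infer_instance

theorem measurable_hermiteTensor (k : G.edgeSet → ℕ) : Measurable (hermiteTensor G k) :=
  Finset.measurable_prod _ fun e _ =>
    (measurable_hermiteNormalized (k e)).comp (measurable_pi_apply e)

theorem hermiteTensor_mul (k l : G.edgeSet → ℕ) (J : Couplings G) :
    hermiteTensor G k J * hermiteTensor G l J =
      ∏ e, hermiteNormalized (k e) (J e) * hermiteNormalized (l e) (J e) :=
  Finset.prod_mul_distrib.symm

theorem memLp_hermiteTensor (k : G.edgeSet → ℕ) :
    MemLp (hermiteTensor G k) 2 (couplingLaw G) := by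
  rw [memLp_two_iff_integrable_sq (measurable_hermiteTensor G k).aestronglyMeasurable]
  simp only [sq, hermiteTensor_mul]
  exact Integrable.fintype_prod fun e => integrable_hermiteNormalized_mul (k e) (k e)

theorem integral_hermiteTensor_mul (k l : G.edgeSet → ℕ) :
    ∫ J, hermiteTensor G k J * hermiteTensor G l J ∂couplingLaw G = if k = l then 1 else 0 := by
  simp only [hermiteTensor_mul, couplingLaw]
  rw [integral_fintype_prod_eq_prod
    (f := fun e x => hermiteNormalized (k e) x * hermiteNormalized (l e) x)]
  simp only [integral_hermiteNormalized_mul, Finset.prod_ite_zero, Finset.prod_const_one,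
    Finset.mem_univ, true_imp_iff, funext_iff]

end HermiteTensor

section Bessel

variable {Ω : Type*} [MeasurableSpace Ω]

theorem inner_toLp {μ : Measure Ω} {f g : Ω → ℝ} (hf : MemLp f 2 μ) (hg : MemLp g 2 μ) :
    inner ℝ (hf.toLp f) (hg.toLp g) = ∫ x, g x * f x ∂μ := by
  rw [L2.inner_def]
  refine integral_congr_ae ?_
  filter_upwards [hf.coeFn_toLp, hg.coeFn_toLp] with x hfx hgx
  simp only [hfx, hgx, RCLike.inner_apply, conj_trivial]

theorem tsum_ofReal_sq_integral_mul_le {κ : Type*} {μ : Measure Ω} {φ : κ → Ω → ℝ}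
    (hφ : ∀ k, MemLp (φ k) 2 μ) (hnorm : ∀ k, ∫ x, φ k x * φ k x ∂μ = 1)
    (horth : Pairwise fun k l => ∫ x, φ k x * φ l x ∂μ = 0) {f : Ω → ℝ} (hf : MemLp f 2 μ) :
    ∑' k, ENNReal.ofReal ((∫ x, f x * φ k x ∂μ) ^ 2) ≤ ENNReal.ofReal (∫ x, f x ^ 2 ∂μ) := by
  have hφ_orthonormal : Orthonormal ℝ fun k => (hφ k).toLp (φ k) := by
    refine ⟨fun k => ?_, fun k l hkl => ?_⟩
    · rw [norm_eq_sqrt_real_inner, inner_toLp, hnorm, Real.sqrt_one]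
    · exact (inner_toLp (hφ k) (hφ l)).trans (horth hkl.symm)
  refine ENNReal.summable.tsum_le_of_sum_le fun s => ?_
  rw [← ENNReal.ofReal_sum_of_nonneg fun _ _ => sq_nonneg _]
  refine ENNReal.ofReal_le_ofReal ?_
  have hbessel := hφ_orthonormal.sum_inner_products_le (hf.toLp f) (s := s)
  rw [← real_inner_self_eq_norm_sq, inner_toLp] at hbessel
  simpa only [inner_toLp, Real.norm_eq_abs, sq_abs, ← sq] using hbessel

end Bessel

section Symmetry

variable {Ω : Type*} [MeasurableSpace Ω] {μ : Measure Ω}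

theorem setIntegral_eq_zero_of_comp_eq_neg {T : Ω → Ω} (hT : MeasurePreserving T μ μ) {B : Set Ω}
    (hB : MeasurableSet B) (hTB : T ⁻¹' B = B) {F : Ω → ℝ} (hF : AEStronglyMeasurable F μ)
    (hneg : ∀ᵐ x ∂μ, x ∈ B → F (T x) = -F x) : ∫ x in B, F x ∂μ = 0 := by
  have hTr : MeasurePreserving T (μ.restrict B) (μ.restrict B) := by
    simpa only [hTB] using hT.restrict_preimage hB
  have hcomp : ∫ x in B, F x ∂μ = ∫ x in B, F (T x) ∂μ := by
    conv_lhs => rw [← hTr.map_eq]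
    exact integral_map hTr.aemeasurable (hTr.map_eq.symm ▸ hF.restrict)
  have hself : ∫ x in B, F x ∂μ = -∫ x in B, F x ∂μ := by
    rw [← integral_neg]
    exact hcomp.trans (setIntegral_congr_ae hB hneg)
  exact self_eq_neg.1 hself

theorem setIntegral_biInter_compl_eq_integral {ι : Type*} {T : ι → Ω → Ω}
    (hT : ∀ i, MeasurePreserving (T i) μ μ) {A : ι → Set Ω} (hA : ∀ i, MeasurableSet (A i))
    (hTA : ∀ i j, T i ⁻¹' A j = A j) {F : Ω → ℝ} (hF : Integrable F μ)
    (hneg : ∀ i, ∀ᵐ x ∂μ, x ∈ A i → F (T i x) = -F x) (s : Finset ι) :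
    ∫ x in ⋂ i ∈ s, (A i)ᶜ, F x ∂μ = ∫ x, F x ∂μ := by
  classical
  induction s using Finset.induction_on with
  | empty => simp
  | insert i s _ ih =>
    set C := ⋂ j ∈ s, (A j)ᶜ with hC
    have hinv : T i ⁻¹' (C ∩ A i) = C ∩ A i := by
      simp only [hC, Set.preimage_inter, Set.preimage_iInter, Set.preimage_compl, hTA]
    have hzero : ∫ x in C ∩ A i, F x ∂μ = 0 :=
      setIntegral_eq_zero_of_comp_eq_neg (hT i)
        ((Finset.measurableSet_biInter s fun j _ => (hA j).compl).inter (hA i)) hinv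
        hF.aestronglyMeasurable ((hneg i).mono fun x hx hxC => hx hxC.2)
    calc ∫ x in ⋂ j ∈ insert i s, (A j)ᶜ, F x ∂μ = ∫ x in C \ A i, F x ∂μ := by
          rw [Finset.set_biInter_insert, Set.inter_comm, ← Set.sdiff_eq]
      _ = ∫ x in C, F x ∂μ := by
          rw [← integral_inter_add_sdiff (s := C) (hA i) hF.integrableOn, hzero, zero_add]
      _ = ∫ x, F x ∂μ := ih

end Symmetry

section ProductMeasure

variable {κ : Type*} {X : κ → Type*} [∀ e, MeasurableSpace (X e)] (μ : ∀ e, Measure (X e))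

theorem measure_pi_eq_zero_of_update [Fintype κ] [DecidableEq κ] [∀ e, SigmaFinite (μ e)]
    {s : Set (∀ e, X e)} (hs : MeasurableSet s) (e : κ)
    (h : ∀ x, μ e {t | Function.update x e t ∈ s} = 0) : Measure.pi μ s = 0 := by
  rw [← lintegral_indicator_one hs]
  refine (lintegral_eq_of_lmarginal_eq {e} (measurable_one.indicator hs) measurable_zero ?_).trans
    lintegral_zero
  ext x
  rw [lmarginal_singleton, lmarginal_singleton]
  simp only [Pi.zero_apply, lintegral_zero]
  exact (lintegral_indicator_one (hs.preimage (measurable_update x))).trans (h x)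

theorem iIndepSet_pi_box [Fintype κ] [∀ e, IsProbabilityMeasure (μ e)] {ι : Type*}
    {T : ι → Finset κ} (hT : Pairwise (Function.onFun Disjoint T)) {W : ι → ∀ e, Set (X e)}
    (hW : ∀ i e, MeasurableSet (W i e)) :
    iIndepSet (fun i => (T i : Set κ).pi (W i)) (Measure.pi μ) := by
  classical
  rw [iIndepSet_iff_meas_biInter fun i => MeasurableSet.pi (T i).countable_toSet fun e _ => hW i e]
  intro s
  have hbox : ⋂ i ∈ s, (T i : Set κ).pi (W i) =
      (s.biUnion T : Set κ).pi fun e => ⋂ i ∈ s, ⋂ (_ : e ∈ T i), W i e := by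
    ext x
    simp only [Set.mem_iInter, Set.mem_pi, Finset.mem_coe, Finset.mem_biUnion]
    exact ⟨fun h e _ i hi he => h i hi e he, fun h i hi e he => h e ⟨i, hi, he⟩ i hi he⟩
  have hside : ∀ i ∈ s, ∀ e ∈ T i, ⋂ j ∈ s, ⋂ (_ : e ∈ T j), W j e = W i e := by
    intro i hi e he
    refine Set.Subset.antisymm (fun x hx => ?_) fun x hx => ?_
    · simp only [Set.mem_iInter] at hx
      exact hx i hi he
    · simp only [Set.mem_iInter]
      intro j _ hj
      obtain rfl : i = j := hT.eq (Finset.not_disjoint_iff.2 ⟨e, he, hj⟩)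
      exact hx
  rw [hbox, Measure.pi_pi_finset, Finset.prod_biUnion fun i _ j _ hij => hT hij]
  refine Finset.prod_congr rfl fun i hi => ?_
  rw [Measure.pi_pi_finset]
  exact Finset.prod_congr rfl fun e he => by rw [hside i hi e he]

end ProductMeasure

section Independence

theorem measure_iInter_compl_le {ι Ω : Type*} [Fintype ι] [MeasurableSpace Ω] {μ : Measure Ω}
    {A : ι → Set Ω} (hA : iIndepSet A μ) (hAm : ∀ i, MeasurableSet (A i)) {p : ℝ≥0∞}
    (hp : ∀ i, p ≤ μ (A i)) : μ (⋂ i, (A i)ᶜ) ≤ (1 - p) ^ Fintype.card ι := by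
  have := hA.isProbabilityMeasure
  rw [(iIndepSet_iff_iIndep _ _).1 hA |>.meas_iInter fun i =>
    (MeasurableSpace.measurableSet_generateFrom (Set.mem_singleton (A i))).compl]
  refine Finset.prod_le_pow_card _ _ _ fun i _ => ?_
  rw [prob_compl_eq_one_sub (hAm i)]
  exact tsub_le_tsub_left (hp i) 1

theorem one_sub_pow_le_ofReal_exp {p : ℝ≥0∞} (hp : p ≤ 1) (m : ℕ) :
    (1 - p) ^ m ≤ ENNReal.ofReal (Real.exp (-(p.toReal * m))) := by
  have hp_top : p ≠ ∞ := ne_top_of_le_ne_top ENNReal.one_ne_top hp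
  have hone_sub : 1 - p = ENNReal.ofReal (1 - p.toReal) := by
    rw [ENNReal.ofReal_sub _ ENNReal.toReal_nonneg, ENNReal.ofReal_one,
      ENNReal.ofReal_toReal hp_top]
  calc (1 - p) ^ m ≤ ENNReal.ofReal (Real.exp (-p.toReal)) ^ m := by
        rw [hone_sub]
        gcongr
        exact Real.one_sub_le_exp_neg _
    _ = ENNReal.ofReal (Real.exp (-(p.toReal * m))) := by
        rw [← ENNReal.ofReal_pow (Real.exp_nonneg _), ← Real.exp_nat_mul]
        congr 2
        ring

end Independence

section Bonds

variable {V : Type*}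

@[simp]
theorem bond_mk (σ : Spins V) (x y : V) : bond σ s(x, y) = σ x * σ y := rfl

theorem bond_mul (σ τ : Spins V) (e : Sym2 V) : bond (σ * τ) e = bond σ e * bond τ e := by
  induction e with
  | h x y => exact mul_mul_mul_comm _ _ _ _

theorem bond_mulSingle [DecidableEq V] (x : V) {e : Sym2 V} (he : ¬ e.IsDiag) :
    bond (Pi.mulSingle x (-1) : Spins V) e = if x ∈ e then -1 else 1 := by
  induction e with
  | h y z =>
    have hyz : y ≠ z := by simpa using he
    by_cases hy : x = y
    · subst hy
      simp [Pi.mulSingle_eq_of_ne hyz.symm]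
    · by_cases hz : x = z
      · subst hz
        simp [Pi.mulSingle_eq_of_ne hyz]
      · simp [Ne.symm hy, Ne.symm hz, hy, hz]

theorem mul_eq_mul_of_forall_mem_edges {G : SimpleGraph V} {σ τ : Spins V} {u v : V}
    (p : G.Walk u v) (h : ∀ e ∈ p.edges, bond σ e = bond τ e) : σ u * σ v = τ u * τ v := by
  induction p with
  | nil => simp only [Int.units_mul_self]
  | @cons x y z hxy p ih =>
    simp only [SimpleGraph.Walk.edges_cons, List.forall_mem_cons, bond_mk] at h
    calc σ x * σ z = (σ x * σ y) * (σ y * σ z) := by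
          rw [mul_assoc, ← mul_assoc (σ y), Int.units_mul_self, one_mul]
      _ = (τ x * τ y) * (τ y * τ z) := by rw [h.1, ih h.2]
      _ = τ x * τ z := by rw [mul_assoc, ← mul_assoc (τ y), Int.units_mul_self, one_mul]

variable (G : SimpleGraph V)

/-- The bonds `σ_x σ_y` of a spin configuration as a pattern of signs on the edges; acting by it
on the couplings is the gauge transformation by `σ`. -/
def bonds (σ : Spins V) : G.edgeSet → ℤˣ := fun e => bond σ e

end Bonds

section GroundStates

variable {V : Type*} (G : SimpleGraph V) [Fintype G.edgeSet]

theorem abs_units_smul (s : ℤˣ) (t : ℝ) : |s • t| = |t| := by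
  rcases Int.units_eq_one_or s with rfl | rfl <;> simp

theorem hamiltonian_eq_sum_smul (J : Couplings G) (σ : Spins V) :
    hamiltonian G J σ = ∑ e : G.edgeSet, bond σ (e : Sym2 V) • J e := by
  simp only [hamiltonian, Units.smul_def, zsmul_eq_mul, mul_comm]

theorem hamiltonian_bonds_smul (η σ : Spins V) (J : Couplings G) :
    hamiltonian G (bonds G η • J) (η * σ) = hamiltonian G J σ := by
  rw [hamiltonian_eq_sum_smul, hamiltonian_eq_sum_smul]
  refine Finset.sum_congr rfl fun e _ => ?_
  rw [Pi.smul_apply', bonds, bond_mul, smul_smul, mul_right_comm, Int.units_mul_self, one_mul]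

theorem hamiltonian_update [DecidableEq G.edgeSet] (J : Couplings G) (e : G.edgeSet) (t : ℝ)
    (σ : Spins V) :
    hamiltonian G (Function.update J e t) σ =
      hamiltonian G J σ + bond σ (e : Sym2 V) • (t - J e) := by
  rw [← sub_eq_iff_eq_add', hamiltonian_eq_sum_smul, hamiltonian_eq_sum_smul,
    ← Finset.sum_sub_distrib]
  refine (Finset.sum_eq_single e (fun e' _ he' => ?_) (by simp)).trans ?_
  · rw [Function.update_of_ne he', sub_self]
  · rw [Function.update_self, smul_sub]

theorem hamiltonian_mulSingle_smul [DecidableEq G.edgeSet] (e : G.edgeSet) (σ : Spins V)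
    (J : Couplings G) :
    hamiltonian G ((Pi.mulSingle e (-1) : G.edgeSet → ℤˣ) • J) σ =
      hamiltonian G J σ - 2 * bond σ (e : Sym2 V) • J e := by
  have hupdate : (Pi.mulSingle e (-1) : G.edgeSet → ℤˣ) • J = Function.update J e (-J e) := by
    ext e'
    rcases eq_or_ne e' e with rfl | he'
    · simp [Units.neg_smul]
    · simp [he']
  rw [hupdate, hamiltonian_update, smul_sub, smul_neg]
  ring

variable {G}

theorem isGroundState_bonds_smul_iff {J : Couplings G} {η σ : Spins V} :
    IsGroundState G (bonds G η • J) (η * σ) ↔ IsGroundState G J σ := by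
  have hsurj : Function.Surjective fun τ : Spins V => η * τ := mul_left_surjective η
  exact hsurj.forall.trans (by simp only [hamiltonian_bonds_smul, IsGroundState])

theorem IsGroundState.of_mulSingle_smul [DecidableEq G.edgeSet] {J : Couplings G} {e : G.edgeSet}
    {σ τ : Spins V} (hσ : IsGroundState G J σ)
    (hτ : IsGroundState G ((Pi.mulSingle e (-1) : G.edgeSet → ℤˣ) • J) τ)
    (he : bond σ (e : Sym2 V) = bond τ (e : Sym2 V)) : IsGroundState G J τ := by
  intro π
  have hτσ := hτ σ
  rw [hamiltonian_mulSingle_smul, hamiltonian_mulSingle_smul, he] at hτσ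
  linarith [hσ π]

open Classical in
/-- The edges of `G` that have `x` as an end. -/
noncomputable def incidentEdges (G : SimpleGraph V) [Fintype G.edgeSet] (x : V) :
    Finset G.edgeSet :=
  {e | x ∈ (e : Sym2 V)}

theorem mem_incidentEdges {x : V} {e : G.edgeSet} :
    e ∈ incidentEdges G x ↔ x ∈ (e : Sym2 V) := by
  simp [incidentEdges]

theorem card_incidentEdges (x : V) {_ : Fintype (G.neighborSet x)} :
    (incidentEdges G x).card = G.degree x := by
  classical
  rw [← SimpleGraph.card_incidenceFinset_eq_degree]
  refine Finset.card_bij (fun e _ => e) (fun e he => ?_) (fun _ _ _ _ => Subtype.ext) fun e he => ?_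
  · exact (SimpleGraph.mem_incidenceFinset G x e).2 ⟨e.2, mem_incidentEdges.1 he⟩
  · obtain ⟨hmem, hx⟩ := (SimpleGraph.mem_incidenceFinset G x e).1 he
    exact ⟨⟨e, hmem⟩, mem_incidentEdges.2 hx, rfl⟩

open Classical in
/-- The coupling on the edge `a` outweighs all the other couplings at its end `x` together, so that
every ground state satisfies `a`. -/
def Dominates (J : Couplings G) (x : V) (a : G.edgeSet) : Prop :=
  x ∈ (a : Sym2 V) ∧ ∑ e ∈ (incidentEdges G x).erase a, |J e| < |J a|

theorem dominates_of_abs_le {J : Couplings G} {x : V} {a : G.edgeSet} (hx : x ∈ (a : Sym2 V))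
    {d : ℕ} (hd : (incidentEdges G x).card ≤ d) {M : ℝ} (hM : 0 ≤ M)
    (hJ : ∀ e : G.edgeSet, x ∈ (e : Sym2 V) → e ≠ a → |J e| ≤ M) (ha : d * M < |J a|) :
    Dominates J x a := by
  classical
  refine ⟨hx, lt_of_le_of_lt ?_ ha⟩
  calc ∑ e ∈ (incidentEdges G x).erase a, |J e|
      ≤ ((incidentEdges G x).erase a).card • M := Finset.sum_le_card_nsmul _ _ _ fun e he =>
        hJ e (mem_incidentEdges.1 (Finset.mem_of_mem_erase he)) (Finset.ne_of_mem_erase he)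
    _ ≤ d * M := by
        rw [nsmul_eq_mul]
        gcongr
        exact (Finset.card_erase_le).trans hd

/-- The edge `a` is dominant at one of its ends, so that the sign of `J a` alone determines the
bond of a ground state across `a`. -/
def IsPinned (J : Couplings G) (a : G.edgeSet) : Prop :=
  ∃ x, Dominates J x a

theorem isPinned_smul_iff {s : G.edgeSet → ℤˣ} {J : Couplings G} {a : G.edgeSet} :
    IsPinned (s • J) a ↔ IsPinned J a := by
  simp only [IsPinned, Dominates, Pi.smul_apply', abs_units_smul]

theorem hamiltonian_sub_hamiltonian_mulSingle_mul [DecidableEq V] (J : Couplings G)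
    (σ : Spins V) (x : V) :
    hamiltonian G J σ - hamiltonian G J (Pi.mulSingle x (-1) * σ) =
      2 * ∑ e ∈ incidentEdges G x, bond σ (e : Sym2 V) • J e := by
  classical
  simp only [hamiltonian_eq_sum_smul, bond_mul]
  rw [← Finset.sum_sub_distrib, Finset.mul_sum, incidentEdges, Finset.sum_filter]
  refine Finset.sum_congr rfl fun e _ => ?_
  rw [bond_mulSingle x (G.not_isDiag_of_mem_edgeSet e.2)]
  split_ifs
  · rw [neg_one_mul, Units.neg_smul]
    ring
  · rw [one_mul, sub_self]

theorem IsGroundState.smul_pos {J : Couplings G} {σ : Spins V} (hσ : IsGroundState G J σ)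
    {a : G.edgeSet} (ha : IsPinned J a) : 0 < bond σ (a : Sym2 V) • J a := by
  classical
  obtain ⟨x, hx, hdom⟩ := ha
  have hlocal : 0 ≤ ∑ e ∈ incidentEdges G x, bond σ (e : Sym2 V) • J e := by
    linarith [hamiltonian_sub_hamiltonian_mulSingle_mul J σ x, hσ (Pi.mulSingle x (-1) * σ)]
  have hrest : ∑ e ∈ (incidentEdges G x).erase a, bond σ (e : Sym2 V) • J e < |J a| :=
    (Finset.sum_le_sum fun e _ => (le_abs_self _).trans (abs_units_smul _ _).le).trans_lt hdom
  rw [← Finset.add_sum_erase _ _ (mem_incidentEdges.2 hx)] at hlocal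
  by_contra! hneg
  have habs := abs_units_smul (bond σ (a : Sym2 V)) (J a)
  rw [abs_of_nonpos hneg] at habs
  linarith

theorem bond_eq_of_isPinned {J J' : Couplings G} {σ τ : Spins V} (hσ : IsGroundState G J σ)
    (hτ : IsGroundState G J' τ) {a : G.edgeSet} (ha : IsPinned J a) (ha' : IsPinned J' a)
    (hJ : J' a = J a) : bond σ (a : Sym2 V) = bond τ (a : Sym2 V) := by
  have hσa := hσ.smul_pos ha
  have hτa := hτ.smul_pos ha'
  rw [hJ] at hτa
  rcases Int.units_eq_one_or (bond σ (a : Sym2 V)) with h | h <;>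
    rcases Int.units_eq_one_or (bond τ (a : Sym2 V)) with h' | h' <;>
    simp only [h, h', one_smul, Units.neg_smul] at hσa hτa ⊢ <;> linarith

/-- All ground states have the same bonds: on a connected graph, the ground state is unique up to
a global sign flip. -/
def UniqueBonds (J : Couplings G) : Prop :=
  ∀ ⦃σ τ : Spins V⦄, IsGroundState G J σ → IsGroundState G J τ → bonds G σ = bonds G τ

variable [Finite V]

theorem isGroundState_groundState (J : Couplings G) : IsGroundState G J (groundState G J) :=
  Classical.choose_spec (exists_isGroundState G J)

theorem relativeSpin_eq (hG : G.Preconnected) {J : Couplings G} (hJ : UniqueBonds J)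
    {σ : Spins V} (hσ : IsGroundState G J σ) (u v : V) :
    relativeSpin G u v J = ((σ u * σ v : ℤˣ) : ℤ) := by
  obtain ⟨p⟩ := hG u v
  have hbonds := congrFun (hJ (isGroundState_groundState J) hσ)
  rw [relativeSpin, mul_eq_mul_of_forall_mem_edges p fun e he =>
    hbonds ⟨e, p.edges_subset_edgeSet he⟩]

theorem abs_relativeSpin (u v : V) (J : Couplings G) : |relativeSpin G u v J| = 1 := by
  rcases Int.units_eq_one_or (groundState G J u * groundState G J v) with h | h <;>
    simp [relativeSpin, h]

theorem relativeSpin_bonds_mul_mulSingle_smul [DecidableEq G.edgeSet] (hG : G.Preconnected)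
    {J : Couplings G} (hJ : UniqueBonds J) (η : Spins V) (e : G.edgeSet)
    (he : ∀ σ τ, IsGroundState G J σ →
      IsGroundState G ((Pi.mulSingle e (-1) : G.edgeSet → ℤˣ) • J) τ →
      bond σ (e : Sym2 V) = bond τ (e : Sym2 V)) (u v : V) :
    relativeSpin G u v ((bonds G η * Pi.mulSingle e (-1)) • J) =
      ((η u * η v : ℤˣ) : ℤ) * relativeSpin G u v J := by
  rw [← smul_smul]
  set K := bonds G η • (Pi.mulSingle e (-1) : G.edgeSet → ℤˣ) • J
  obtain ⟨τ, hτ⟩ : ∃ τ, groundState G K = η * τ := (mul_left_surjective η (groundState G K)).imp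
    fun _ => Eq.symm
  have hτ_flip : IsGroundState G ((Pi.mulSingle e (-1) : G.edgeSet → ℤˣ) • J) τ :=
    isGroundState_bonds_smul_iff.1 (hτ ▸ isGroundState_groundState K)
  have hτ_ground : IsGroundState G J τ :=
    (isGroundState_groundState J).of_mulSingle_smul hτ_flip
      (he _ _ (isGroundState_groundState J) hτ_flip)
  rw [relativeSpin_eq hG hJ hτ_ground, relativeSpin, hτ]
  simp only [Pi.mul_apply, mul_mul_mul_comm (η u)]
  push_cast
  rfl

theorem relativeSpin_bonds_mul_mulSingle_smul_of_walk [DecidableEq G.edgeSet]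
    (hG : G.Preconnected) {J : Couplings G} (hJ : UniqueBonds J) (η : Spins V) {e : G.edgeSet}
    {x y : V} (hxy : (e : Sym2 V) = s(x, y)) (p : G.Walk x y)
    (hp : ∀ a : G.edgeSet, (a : Sym2 V) ∈ p.edges → a ≠ e ∧ IsPinned J a) (u v : V) :
    relativeSpin G u v ((bonds G η * Pi.mulSingle e (-1)) • J) =
      ((η u * η v : ℤˣ) : ℤ) * relativeSpin G u v J := by
  refine relativeSpin_bonds_mul_mulSingle_smul hG hJ η e (fun σ τ hσ hτ => ?_) u v
  rw [hxy, bond_mk, bond_mk]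
  refine mul_eq_mul_of_forall_mem_edges p fun a ha => ?_
  obtain ⟨hae, hpin⟩ := hp ⟨a, p.edges_subset_edgeSet ha⟩ ha
  refine bond_eq_of_isPinned hσ hτ hpin (isPinned_smul_iff.2 hpin) ?_
  rw [Pi.smul_apply', Pi.mulSingle_eq_of_ne hae, one_smul]

end GroundStates

section Law

variable {V : Type*} (G : SimpleGraph V) [Fintype G.edgeSet]

theorem measurable_hamiltonian (σ : Spins V) : Measurable fun J => hamiltonian G J σ := by
  unfold hamiltonian
  fun_prop

theorem measurePreserving_smul_couplingLaw (s : G.edgeSet → ℤˣ) :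
    MeasurePreserving (fun J => s • J) (couplingLaw G) (couplingLaw G) := by
  refine measurePreserving_pi _ _ (f := fun e (t : ℝ) => s e • t) fun e => ?_
  rcases Int.units_eq_one_or (s e) with h | h
  · simpa only [h, one_smul] using! MeasurePreserving.id (gaussianReal 0 1)
  · simp only [h, Units.neg_smul, one_smul]
    exact ⟨measurable_neg, by simpa only [neg_zero] using gaussianReal_map_neg (μ := 0) (v := 1)⟩

theorem ae_hamiltonian_ne {σ τ : Spins V} (h : bonds G σ ≠ bonds G τ) :
    ∀ᵐ J ∂couplingLaw G, hamiltonian G J σ ≠ hamiltonian G J τ := by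
  classical
  obtain ⟨e, he⟩ := Function.ne_iff.1 h
  have := nullSingletonClass_gaussianReal (μ := 0) (v := 1) one_ne_zero
  have hnull : couplingLaw G {J | hamiltonian G J σ = hamiltonian G J τ} = 0 := by
    refine measure_pi_eq_zero_of_update _ (measurableSet_eq_fun (measurable_hamiltonian G σ)
      (measurable_hamiltonian G τ)) e fun J => Set.Subsingleton.measure_zero ?_ _
    intro t ht t' ht'
    simp only [Set.mem_ofPred_eq, hamiltonian_update, bonds] at ht ht' he
    rw [Int.units_ne_iff_eq_neg.1 he, Units.neg_smul] at ht ht'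
    have hsmul : bond τ (e : Sym2 V) • (t - J e) = bond τ (e : Sym2 V) • (t' - J e) := by linarith
    exact sub_left_injective (smul_left_cancel _ hsmul)
  simpa [ae_iff] using hnull

variable [Finite V]

theorem ae_uniqueBonds : ∀ᵐ J ∂couplingLaw G, UniqueBonds J := by
  have hne : ∀ᵐ J ∂couplingLaw G, ∀ σ τ : Spins V, bonds G σ ≠ bonds G τ →
      hamiltonian G J σ ≠ hamiltonian G J τ := by
    simp only [ae_all_iff]
    exact fun σ τ => ae_hamiltonian_ne G
  filter_upwards [hne] with J hJ σ τ hσ hτ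
  by_contra h
  exact hJ σ τ h (le_antisymm (hτ σ) (hσ τ))

theorem measurableSet_isGroundState (σ : Spins V) :
    MeasurableSet {J : Couplings G | IsGroundState G J σ} := by
  simp only [IsGroundState, Set.ofPred_forall]
  exact MeasurableSet.iInter fun τ =>
    measurableSet_le (measurable_hamiltonian G τ) (measurable_hamiltonian G σ)

variable {G}

theorem aestronglyMeasurable_relativeSpin (hG : G.Preconnected) (u v : V) :
    AEStronglyMeasurable (relativeSpin G u v) (couplingLaw G) := by
  classical
  have hmeas : MeasurableSet {J | ∃ σ : Spins V, σ u * σ v = 1 ∧ IsGroundState G J σ} := by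
    simp only [Set.ofPred_exists, Set.ofPred_and]
    exact MeasurableSet.iUnion fun σ => (MeasurableSet.const _).inter
      (measurableSet_isGroundState G σ)
  have hite : Measurable fun J : Couplings G =>
      if ∃ σ : Spins V, σ u * σ v = 1 ∧ IsGroundState G J σ then (1 : ℝ) else -1 :=
    Measurable.ite hmeas measurable_const measurable_const
  refine hite.aestronglyMeasurable.congr ?_
  filter_upwards [ae_uniqueBonds G] with J hJ
  split_ifs with hmem
  · obtain ⟨σ, hσ_uv, hσ⟩ := hmem
    rw [relativeSpin_eq hG hJ hσ, hσ_uv, Units.val_one, Int.cast_one]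
  · rcases Int.units_eq_one_or (groundState G J u * groundState G J v) with h | h
    · exact absurd ⟨_, h, isGroundState_groundState J⟩ hmem
    · rw [relativeSpin, h, Units.val_neg, Units.val_one, Int.cast_neg, Int.cast_one]

theorem memLp_relativeSpin (hG : G.Preconnected) (u v : V) :
    MemLp (relativeSpin G u v) 2 (couplingLaw G) :=
  .of_bound (aestronglyMeasurable_relativeSpin hG u v) 1
    (.of_forall fun J => (abs_relativeSpin u v J).le)

end Law

section Spectral

variable {V : Type*} {G : SimpleGraph V} [Fintype G.edgeSet]

theorem hermiteTensor_smul {k : G.edgeSet → ℕ} {s : G.edgeSet → ℤˣ}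
    (h : ∀ e ∈ indexSupport G k, s e = 1) (J : Couplings G) :
    hermiteTensor G k (s • J) = hermiteTensor G k J := by
  refine Finset.prod_congr rfl fun e _ => ?_
  rcases Nat.eq_zero_or_pos (k e) with hk | hk
  · rw [hk, hermiteNormalized_zero, hermiteNormalized_zero]
  · rw [Pi.smul_apply', h e hk, one_smul]

variable [Finite V]

theorem spectralMass_eq_tsum (u v : V) (S : Set G.edgeSet) :
    spectralMass G u v S =
      ∑' k : {k // indexSupport G k = S}, ENNReal.ofReal (fourierCoeff G u v k ^ 2) := by
  have hS : MeasurableSet {k : G.edgeSet → ℕ | indexSupport G k = S} :=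
    (Set.to_countable _).measurableSet
  rw [spectralMass, spectralMeasure, Measure.sum_apply _ hS]
  refine Eq.trans ?_ (tsum_subtype {k | indexSupport G k = S} fun k =>
    ENNReal.ofReal (fourierCoeff G u v k ^ 2)).symm
  refine tsum_congr fun k => ?_
  rw [Measure.smul_apply, Measure.dirac_apply' _ hS, smul_eq_mul, Set.indicator_apply,
    Set.indicator_apply, Pi.one_apply, mul_ite, mul_one, mul_zero]

theorem fourierCoeff_eq_integral_indicator (hG : G.Preconnected) (u v : V) {k : G.edgeSet → ℕ}
    {ι : Type*} [Finite ι] {A : ι → Set (Couplings G)} (hA : ∀ i, MeasurableSet (A i))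
    (hA_smul : ∀ i (s : G.edgeSet → ℤˣ) J, s • J ∈ A i ↔ J ∈ A i) {s : ι → G.edgeSet → ℤˣ}
    (hs : ∀ i, ∀ e ∈ indexSupport G k, s i e = 1)
    (hneg : ∀ i, ∀ᵐ J ∂couplingLaw G, J ∈ A i →
      relativeSpin G u v (s i • J) = -relativeSpin G u v J) :
    fourierCoeff G u v k =
      ∫ J, (⋂ i, (A i)ᶜ).indicator (relativeSpin G u v) J * hermiteTensor G k J ∂couplingLaw G := by
  have := Fintype.ofFinite ι
  have hneg_mul : ∀ i, ∀ᵐ J ∂couplingLaw G, J ∈ A i →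
      relativeSpin G u v (s i • J) * hermiteTensor G k (s i • J) =
        -(relativeSpin G u v J * hermiteTensor G k J) := fun i => by
    filter_upwards [hneg i] with J hJ hJA
    rw [hJ hJA, hermiteTensor_smul (hs i), neg_mul]
  have hint : Integrable (fun J => relativeSpin G u v J * hermiteTensor G k J) (couplingLaw G) :=
    (memLp_relativeSpin hG u v).integrable_mul (memLp_hermiteTensor G k)
  have hset := setIntegral_biInter_compl_eq_integral
    (fun i => measurePreserving_smul_couplingLaw G (s i)) hA
    (fun i j => Set.ext fun J => hA_smul j (s i) J) hint hneg_mul Finset.univ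
  simp only [Finset.mem_univ, Set.iInter_true] at hset
  rw [fourierCoeff, ← hset, ← integral_indicator (MeasurableSet.iInter fun i => (hA i).compl)]
  simp only [Set.indicator_mul_left]

theorem integral_sq_indicator_relativeSpin (u v : V) {N : Set (Couplings G)}
    (hN : MeasurableSet N) :
    ∫ J, N.indicator (relativeSpin G u v) J ^ 2 ∂couplingLaw G = (couplingLaw G).real N := by
  rw [← integral_indicator_one hN]
  congr 1 with J
  by_cases hJ : J ∈ N
  · rw [Set.indicator_of_mem hJ, Set.indicator_of_mem hJ, ← sq_abs, abs_relativeSpin, one_pow,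
      Pi.one_apply]
  · rw [Set.indicator_of_notMem hJ, Set.indicator_of_notMem hJ, zero_pow two_ne_zero]

theorem spectralMass_le_measure_iInter_compl (hG : G.Preconnected) (u v : V) {S : Set G.edgeSet}
    {ι : Type*} [Finite ι] {A : ι → Set (Couplings G)} (hA : ∀ i, MeasurableSet (A i))
    (hA_smul : ∀ i (s : G.edgeSet → ℤˣ) J, s • J ∈ A i ↔ J ∈ A i) {s : ι → G.edgeSet → ℤˣ}
    (hs : ∀ i, ∀ e ∈ S, s i e = 1)
    (hneg : ∀ i, ∀ᵐ J ∂couplingLaw G, J ∈ A i →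
      relativeSpin G u v (s i • J) = -relativeSpin G u v J) :
    spectralMass G u v S ≤ couplingLaw G (⋂ i, (A i)ᶜ) := by
  set N := ⋂ i, (A i)ᶜ
  have hNm : MeasurableSet N := MeasurableSet.iInter fun i => (hA i).compl
  calc spectralMass G u v S
      = ∑' k : {k // indexSupport G k = S}, ENNReal.ofReal
          ((∫ J, N.indicator (relativeSpin G u v) J * hermiteTensor G k J ∂couplingLaw G) ^ 2) := by
        rw [spectralMass_eq_tsum]
        refine tsum_congr fun k => ?_
        rw [fourierCoeff_eq_integral_indicator hG u v hA hA_smul (by simpa only [k.2] using hs)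
          hneg]
    _ ≤ ENNReal.ofReal (∫ J, N.indicator (relativeSpin G u v) J ^ 2 ∂couplingLaw G) :=
        tsum_ofReal_sq_integral_mul_le
          (φ := fun k : {k // indexSupport G k = S} => hermiteTensor G k)
          (fun k => memLp_hermiteTensor G k)
          (fun k => by rw [integral_hermiteTensor_mul, if_pos rfl])
          (fun k l hkl => (integral_hermiteTensor_mul G k.1 l.1).trans
            (if_neg (Subtype.coe_ne_coe.2 hkl)))
          ((memLp_relativeSpin hG u v).indicator hNm)
    _ = couplingLaw G N := by rw [integral_sq_indicator_relativeSpin u v hNm, ofReal_measureReal]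

end Spectral

section Shells

/-- The two symmetric intervals `a < |t| < a + 1`: a constraint on a coupling that is insensitive to
its sign. -/
def shell (a : ℝ) : Set ℝ := {t | |t| ∈ Set.Ioo a (a + 1)}

theorem isOpen_shell (a : ℝ) : IsOpen (shell a) :=
  isOpen_Ioo.preimage continuous_abs

theorem gaussianReal_shell_pos {a : ℝ} (ha : 0 ≤ a) : 0 < gaussianReal 0 1 (shell a) := by
  have := (gaussianReal_absolutelyContinuous' 0 one_ne_zero).isOpenPosMeasure
  refine (isOpen_shell a).measure_pos _ ⟨a + 1 / 2, ?_⟩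
  rw [shell, Set.mem_ofPred_eq, abs_of_nonneg (by positivity)]
  constructor <;> linarith

/-- A lower bound, on a graph with at most `d` edges at each vertex, for the probability of
`Plaquette.event`, which constrains at most `4 * d` couplings. -/
noncomputable def plaquetteProb (d : ℕ) : ℝ≥0∞ :=
  min (gaussianReal 0 1 (shell (d * (d + 1))))
    (min (gaussianReal 0 1 (shell d)) (gaussianReal 0 1 (shell 0))) ^ (4 * d)

theorem plaquetteProb_pos (d : ℕ) : 0 < plaquetteProb d :=
  ENNReal.pow_pos (lt_min (gaussianReal_shell_pos (by positivity))
    (lt_min (gaussianReal_shell_pos (by positivity)) (gaussianReal_shell_pos le_rfl))) _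

theorem plaquetteProb_le_one (d : ℕ) : plaquetteProb d ≤ 1 :=
  pow_le_one' ((min_le_left _ _).trans prob_le_one) _

end Shells

/-- A 4-cycle in `G`, with one of its edges singled out as the base. -/
structure Plaquette {V : Type*} (G : SimpleGraph V) where
  baseLeft : V
  baseRight : V
  topLeft : V
  topRight : V
  adj_base : G.Adj baseLeft baseRight
  adj_left : G.Adj baseLeft topLeft
  adj_top : G.Adj topLeft topRight
  adj_right : G.Adj topRight baseRight
  baseLeft_ne_topRight : baseLeft ≠ topRight
  baseRight_ne_topLeft : baseRight ≠ topLeft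

namespace Plaquette

variable {V : Type*} {G : SimpleGraph V} (P : Plaquette G)

/-- The base of a plaquette: the edge whose coupling changes sign. -/
def base : G.edgeSet := ⟨s(P.baseLeft, P.baseRight), P.adj_base⟩

/-- The side of a plaquette at the left end of its base. -/
def left : G.edgeSet := ⟨s(P.baseLeft, P.topLeft), P.adj_left⟩

/-- The side of a plaquette opposite to its base. -/
def top : G.edgeSet := ⟨s(P.topLeft, P.topRight), P.adj_top⟩

/-- The side of a plaquette at the right end of its base. -/
def right : G.edgeSet := ⟨s(P.topRight, P.baseRight), P.adj_right⟩

/-- The path along the three other sides that joins the ends of the base. -/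
def detour : G.Walk P.baseLeft P.baseRight :=
  .cons P.adj_left (.cons P.adj_top (.cons P.adj_right .nil))

theorem mem_edges_detour {e : G.edgeSet} :
    (e : Sym2 V) ∈ P.detour.edges ↔ e = P.left ∨ e = P.top ∨ e = P.right := by
  simp [detour, left, top, right, Subtype.ext_iff]

theorem ne_base_of_mem_edges_detour {e : G.edgeSet} (he : (e : Sym2 V) ∈ P.detour.edges) :
    e ≠ P.base := by
  have hl := P.baseLeft_ne_topRight
  have hr := P.baseRight_ne_topLeft
  have hll := P.adj_left.ne
  have hrr := P.adj_right.ne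
  rcases P.mem_edges_detour.1 he with rfl | rfl | rfl <;>
    simp only [left, top, right, base, ne_eq, Subtype.ext_iff, Sym2.eq_iff] <;> tauto

open Classical in
/-- The sizes of the couplings around a plaquette, on a graph with at most `d` edges at each vertex:
with `|J e|` in `shell (P.strength d e)`, the sides are dominant at the ends of the base and the top
is dominant at both of its ends. -/
noncomputable def strength (d : ℕ) (e : G.edgeSet) : ℝ :=
  if e = P.top then d * (d + 1) else if e = P.left ∨ e = P.right then d else 0

theorem baseLeft_notMem_top : P.baseLeft ∉ (P.top : Sym2 V) := by
  simp [top, P.adj_left.ne, P.baseLeft_ne_topRight]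

theorem baseRight_notMem_top : P.baseRight ∉ (P.top : Sym2 V) := by
  simp [top, P.adj_right.ne.symm, P.baseRight_ne_topLeft]

theorem strength_top (d : ℕ) : P.strength d P.top = d * (d + 1) := if_pos rfl

theorem strength_left (d : ℕ) : P.strength d P.left = d := by
  have hne : P.left ≠ P.top := fun h => P.baseLeft_notMem_top (h ▸ Sym2.mem_mk_left _ _)
  rw [strength, if_neg hne, if_pos (.inl rfl)]

theorem strength_right (d : ℕ) : P.strength d P.right = d := by
  have hne : P.right ≠ P.top := fun h => P.baseRight_notMem_top (h ▸ Sym2.mem_mk_right _ _)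
  rw [strength, if_neg hne, if_pos (.inr rfl)]

theorem strength_le_of_ne_top (d : ℕ) {e : G.edgeSet} (he : e ≠ P.top) : P.strength d e ≤ d := by
  rw [strength, if_neg he]
  split_ifs
  · exact le_rfl
  · exact d.cast_nonneg

theorem strength_eq_zero_of_baseLeft_mem (d : ℕ) {e : G.edgeSet}
    (he : P.baseLeft ∈ (e : Sym2 V)) (hne : e ≠ P.left) : P.strength d e = 0 := by
  have hnot_top : e ≠ P.top := by
    rintro rfl
    exact P.baseLeft_notMem_top he
  have hnot_right : e ≠ P.right := by
    rintro rfl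
    simp [right, P.adj_base.ne, P.baseLeft_ne_topRight] at he
  rw [strength, if_neg hnot_top, if_neg (not_or_intro hne hnot_right)]

theorem strength_eq_zero_of_baseRight_mem (d : ℕ) {e : G.edgeSet}
    (he : P.baseRight ∈ (e : Sym2 V)) (hne : e ≠ P.right) : P.strength d e = 0 := by
  have hnot_top : e ≠ P.top := by
    rintro rfl
    exact P.baseRight_notMem_top he
  have hnot_left : e ≠ P.left := by
    rintro rfl
    simp [left, P.adj_base.ne.symm, P.baseRight_ne_topLeft] at he
  rw [strength, if_neg hnot_top, if_neg (not_or_intro hnot_left hne)]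

open Classical in
/-- The four vertices of a plaquette. -/
noncomputable def corners : Finset V := {P.baseLeft, P.baseRight, P.topLeft, P.topRight}

theorem baseLeft_mem_corners : P.baseLeft ∈ P.corners := by simp [corners]

theorem baseRight_mem_corners : P.baseRight ∈ P.corners := by simp [corners]

theorem topLeft_mem_corners : P.topLeft ∈ P.corners := by simp [corners]

variable [Fintype G.edgeSet]

open Classical in
/-- The edges of `G` that have a corner of the plaquette as an end. -/
noncomputable def star : Finset G.edgeSet := P.corners.biUnion (incidentEdges G)

variable {P} in
theorem mem_star {e : G.edgeSet} : e ∈ P.star ↔ ∃ w ∈ P.corners, w ∈ (e : Sym2 V) := by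
  simp only [star, Finset.mem_biUnion, mem_incidentEdges]

variable {P} in
theorem disjoint_star {Q : Plaquette G}
    (h : ∀ w ∈ P.corners, ∀ z ∈ Q.corners, w ≠ z ∧ ¬ G.Adj w z) : Disjoint P.star Q.star := by
  refine Finset.disjoint_left.2 fun e heP heQ => ?_
  obtain ⟨w, hw, hwe⟩ := mem_star.1 heP
  obtain ⟨z, hz, hze⟩ := mem_star.1 heQ
  obtain ⟨hwz, hadj⟩ := h w hw z hz
  rw [← SimpleGraph.mem_edgeSet, ← (Sym2.mem_and_mem_iff hwz).1 ⟨hwe, hze⟩] at hadj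
  exact hadj e.2

variable {P} in
theorem card_star_le {d : ℕ} (hd : ∀ w, (incidentEdges G w).card ≤ d) : P.star.card ≤ 4 * d := by
  classical
  exact (Finset.card_biUnion_le_card_mul _ _ d fun w _ => hd w).trans
    (Nat.mul_le_mul_right d Finset.card_le_four)

/-- The couplings around the plaquette are such that, whatever their signs, the three edges of the
detour are pinned. -/
def event (d : ℕ) : Set (Couplings G) :=
  (P.star : Set G.edgeSet).pi fun e => shell (P.strength d e)

theorem measurableSet_event (d : ℕ) : MeasurableSet (P.event d) :=
  .pi P.star.countable_toSet fun _ _ => (isOpen_shell _).measurableSet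

variable {P} in
theorem smul_mem_event {d : ℕ} {s : G.edgeSet → ℤˣ} {J : Couplings G} :
    s • J ∈ P.event d ↔ J ∈ P.event d := by
  simp only [event, shell, Set.mem_pi, Set.mem_ofPred_eq, Pi.smul_apply', abs_units_smul]

theorem plaquetteProb_le_couplingLaw_event {d : ℕ} (hd : ∀ w, (incidentEdges G w).card ≤ d) :
    plaquetteProb d ≤ couplingLaw G (P.event d) := by
  set p := min (gaussianReal 0 1 (shell (d * (d + 1))))
    (min (gaussianReal 0 1 (shell d)) (gaussianReal 0 1 (shell 0)))
  have hp_le : ∀ e, p ≤ gaussianReal 0 1 (shell (P.strength d e)) := fun e => by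
    rw [strength]
    split_ifs
    · exact min_le_left _ _
    · exact (min_le_right _ _).trans (min_le_left _ _)
    · exact (min_le_right _ _).trans (min_le_right _ _)
  calc plaquetteProb d ≤ p ^ P.star.card :=
        pow_le_pow_right_of_le_one' ((min_le_left _ _).trans prob_le_one) (card_star_le hd)
    _ ≤ ∏ e ∈ P.star, gaussianReal 0 1 (shell (P.strength d e)) :=
        Finset.pow_card_le_prod _ _ _ fun e _ => hp_le e
    _ = couplingLaw G (P.event d) := (Measure.pi_pi_finset _ _ _).symm

theorem iIndepSet_event (d : ℕ) {ι : Type*} {P : ι → Plaquette G}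
    (hP : Pairwise (Function.onFun Disjoint fun i => (P i).star)) :
    iIndepSet (fun i => (P i).event d) (couplingLaw G) :=
  iIndepSet_pi_box _ hP fun _ _ => (isOpen_shell _).measurableSet

variable {P} in
theorem isPinned_of_mem_event {d : ℕ} (hd : ∀ w, (incidentEdges G w).card ≤ d) {J : Couplings G}
    (hJ : J ∈ P.event d) {e : G.edgeSet} (he : (e : Sym2 V) ∈ P.detour.edges) : IsPinned J e := by
  have hshell : ∀ w ∈ P.corners, ∀ e : G.edgeSet, w ∈ (e : Sym2 V) →
      |J e| ∈ Set.Ioo (P.strength d e) (P.strength d e + 1) := fun w hw e hwe =>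
    hJ e (mem_star.2 ⟨w, hw, hwe⟩)
  have hweak : ∀ w ∈ P.corners, ∀ e : G.edgeSet, w ∈ (e : Sym2 V) → P.strength d e = 0 →
      |J e| ≤ 1 := fun w hw e hwe h0 => by simpa only [h0, zero_add] using (hshell w hw e hwe).2.le
  rcases P.mem_edges_detour.1 he with rfl | rfl | rfl
  · have hx : P.baseLeft ∈ (P.left : Sym2 V) := Sym2.mem_mk_left _ _
    refine ⟨P.baseLeft, dominates_of_abs_le hx (hd _) zero_le_one (fun e hxe hne =>
      hweak _ P.baseLeft_mem_corners e hxe (P.strength_eq_zero_of_baseLeft_mem d hxe hne)) ?_⟩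
    simpa only [strength_left, mul_one] using (hshell _ P.baseLeft_mem_corners _ hx).1
  · have hx : P.topLeft ∈ (P.top : Sym2 V) := Sym2.mem_mk_left _ _
    have hle : ∀ e : G.edgeSet, P.topLeft ∈ (e : Sym2 V) → e ≠ P.top → |J e| ≤ d + 1 :=
      fun e hxe hne => (hshell _ P.topLeft_mem_corners e hxe).2.le.trans
        (add_le_add_left (P.strength_le_of_ne_top d hne) 1)
    refine ⟨P.topLeft, dominates_of_abs_le hx (hd _) (by positivity) hle ?_⟩
    simpa only [strength_top] using (hshell _ P.topLeft_mem_corners _ hx).1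
  · have hx : P.baseRight ∈ (P.right : Sym2 V) := Sym2.mem_mk_right _ _
    refine ⟨P.baseRight, dominates_of_abs_le hx (hd _) zero_le_one (fun e hxe hne =>
      hweak _ P.baseRight_mem_corners e hxe (P.strength_eq_zero_of_baseRight_mem d hxe hne)) ?_⟩
    simpa only [strength_right, mul_one] using (hshell _ P.baseRight_mem_corners _ hx).1

end Plaquette

section Bound

variable {V : Type*} [Finite V] {G : SimpleGraph V} [Fintype G.edgeSet]

theorem spectralMass_le_of_plaquettes [DecidableEq G.edgeSet] (hG : G.Preconnected) {d : ℕ}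
    (hd : ∀ w, (incidentEdges G w).card ≤ d) {u v : V} {S : Set G.edgeSet} {ι : Type*} [Fintype ι]
    {P : ι → Plaquette G} (hP : Pairwise (Function.onFun Disjoint fun i => (P i).star))
    {η : ι → Spins V} (hη : ∀ i, η i u * η i v = -1)
    (hS : ∀ i, ∀ e ∈ S, bonds G (η i) e = Pi.mulSingle (M := fun _ => ℤˣ) (P i).base (-1) e) :
    spectralMass G u v S ≤ (1 - plaquetteProb d) ^ Fintype.card ι := by
  have hsign : ∀ i, ∀ e ∈ S,
      (bonds G (η i) * Pi.mulSingle (P i).base (-1) : G.edgeSet → ℤˣ) e = 1 :=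
    fun i e he => by rw [Pi.mul_apply, hS i e he, Int.units_mul_self]
  have hneg : ∀ i, ∀ᵐ J ∂couplingLaw G, J ∈ (P i).event d →
      relativeSpin G u v ((bonds G (η i) * Pi.mulSingle (P i).base (-1)) • J) =
        -relativeSpin G u v J := fun i => by
    filter_upwards [ae_uniqueBonds G] with J hJ hJP
    rw [relativeSpin_bonds_mul_mulSingle_smul_of_walk hG hJ (η i) rfl (P i).detour fun a ha =>
      ⟨(P i).ne_base_of_mem_edges_detour ha, Plaquette.isPinned_of_mem_event hd hJP ha⟩, hη]
    simp
  have hmeas : ∀ i, MeasurableSet ((P i).event d) := fun i => (P i).measurableSet_event d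
  calc spectralMass G u v S ≤ couplingLaw G (⋂ i, ((P i).event d)ᶜ) :=
        spectralMass_le_measure_iInter_compl hG u v hmeas
          (fun _ _ _ => Plaquette.smul_mem_event) hsign hneg
    _ ≤ (1 - plaquetteProb d) ^ Fintype.card ι :=
        measure_iInter_compl_le (Plaquette.iIndepSet_event d hP) hmeas fun i =>
          (P i).plaquetteProb_le_couplingLaw_event hd

end Bound

section BoxProd

variable {V W : Type*} {G : SimpleGraph V} {H : SimpleGraph W}

/-- The plaquette in `G □ H` spanned by an edge of `G` and an edge of `H`. -/
def boxProdPlaquette {a b : V} (hab : G.Adj a b) {r r' : W} (hr : H.Adj r r') :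
    Plaquette (G.boxProd H) where
  baseLeft := (a, r)
  baseRight := (b, r)
  topLeft := (a, r')
  topRight := (b, r')
  adj_base := SimpleGraph.boxProd_adj_left.2 hab
  adj_left := SimpleGraph.boxProd_adj_right.2 hr
  adj_top := SimpleGraph.boxProd_adj_left.2 hab
  adj_right := SimpleGraph.boxProd_adj_right.2 hr.symm
  baseLeft_ne_topRight h := hab.ne (congrArg Prod.fst h)
  baseRight_ne_topLeft h := hab.ne (congrArg Prod.fst h).symm

theorem fst_eq_or_of_mem_corners_boxProdPlaquette {a b : V} {hab : G.Adj a b} {r r' : W}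
    {hr : H.Adj r r'} {w : V × W} (hw : w ∈ (boxProdPlaquette hab hr).corners) :
    w.1 = a ∨ w.1 = b := by
  simp only [Plaquette.corners, boxProdPlaquette, Finset.mem_insert, Finset.mem_singleton] at hw
  rcases hw with rfl | rfl | rfl | rfl <;> simp

end BoxProd

section Grid

variable {n : ℕ}

theorem grid_preconnected (n : ℕ) : (grid n).Preconnected :=
  (SimpleGraph.pathGraph_preconnected n).boxProd (SimpleGraph.pathGraph_preconnected n)

theorem degree_pathGraph_le_two (i : Fin n)
    [Fintype ((SimpleGraph.pathGraph n).neighborSet i)] :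
    (SimpleGraph.pathGraph n).degree i ≤ 2 := by
  refine (Finset.card_le_card_of_injOn (t := {(i : ℕ) + 1, (i : ℕ) - 1}) Fin.val
    (fun j hj => ?_) Fin.val_injective.injOn).trans Finset.card_le_two
  have hij : (SimpleGraph.pathGraph n).Adj i j := by simpa using hj
  rw [SimpleGraph.pathGraph_adj] at hij
  simp only [Finset.coe_insert, Finset.coe_singleton, Set.mem_insert_iff, Set.mem_singleton_iff]
  omega

theorem card_incidentEdges_grid_le (x : Fin n × Fin n) : (incidentEdges (grid n) x).card ≤ 4 := by
  classical
  calc (incidentEdges (grid n) x).card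
      = (SimpleGraph.pathGraph n).degree x.1 + (SimpleGraph.pathGraph n).degree x.2 :=
        (card_incidentEdges x).trans (SimpleGraph.degree_boxProd x)
    _ ≤ 2 + 2 := add_le_add (degree_pathGraph_le_two _) (degree_pathGraph_le_two _)

/-- The gauge transformation that negates all spins to the right of column `l` (counted from
`0`). -/
def rightHalf (n l : ℕ) : Spins (Fin n × Fin n) := fun w => if (w.1 : ℕ) ≤ l then 1 else -1

theorem pathGraph_adj_succ {l : ℕ} (hl : l + 1 < n) :
    (SimpleGraph.pathGraph n).Adj ⟨l, by omega⟩ ⟨l + 1, hl⟩ :=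
  SimpleGraph.pathGraph_adj.2 (.inl rfl)

/-- The plaquette in columns `l` and `l + 1` of the grid (counted from `0`) whose base and top are
in the neighbouring rows `r` and `r'`. -/
def gridPlaquette {l : ℕ} (hl : l + 1 < n) {r r' : Fin n}
    (hr : (SimpleGraph.pathGraph n).Adj r r') : Plaquette (grid n) :=
  boxProdPlaquette (pathGraph_adj_succ hl) hr

theorem disjoint_star_gridPlaquette {l m : ℕ} (hl : l + 1 < n) (hm : m + 1 < n)
    (hlm : l + 2 < m) {r r' : Fin n} (hr : (SimpleGraph.pathGraph n).Adj r r') :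
    Disjoint (gridPlaquette hl hr).star (gridPlaquette hm hr).star := by
  refine Plaquette.disjoint_star fun w hw z hz => ?_
  have hw := fst_eq_or_of_mem_corners_boxProdPlaquette hw
  have hz := fst_eq_or_of_mem_corners_boxProdPlaquette hz
  simp only [Fin.ext_iff] at hw hz
  refine ⟨fun h => ?_, fun h => ?_⟩
  · rw [h] at hw
    omega
  · simp only [grid, SimpleGraph.boxProd_adj, SimpleGraph.pathGraph_adj, Fin.ext_iff] at h
    omega

theorem bonds_rightHalf_of_mem_horizontalLine [DecidableEq (grid n).edgeSet] {j : ℕ}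
    (hj : 1 ≤ j ∧ j ≤ n) {l : ℕ} (hl : l + 1 < n) {r' : Fin n}
    (hr : (SimpleGraph.pathGraph n).Adj ⟨j - 1, by omega⟩ r')
    {e : (grid n).edgeSet} (he : e ∈ horizontalLine n j hj) :
    bonds (grid n) (rightHalf n l) e =
      Pi.mulSingle (M := fun _ => ℤˣ) (gridPlaquette hl hr).base (-1) e := by
  obtain ⟨e, hmem⟩ := e
  obtain ⟨k, hk, rfl⟩ : ∃ k, ∃ hk : 1 ≤ k ∧ k < n, e = s(_, _) := he
  rcases eq_or_ne k (l + 1) with rfl | hkl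
  · refine Eq.trans ?_ (Pi.mulSingle_eq_same (M := fun _ => ℤˣ) _ _).symm
    simp [bonds, rightHalf, vertex]
  · rw [Pi.mulSingle_eq_of_ne]
    · simp only [bonds, bond_mk, rightHalf, vertex]
      split_ifs <;> first | rfl | omega
    · simp only [Plaquette.base, gridPlaquette, boxProdPlaquette, vertex, ne_eq,
        Subtype.mk.injEq, Sym2.eq_iff, Prod.mk.injEq, Fin.mk.injEq]
      omega

theorem spectralMass_horizontalLine_le (hn : 2 ≤ n) {j : ℕ} (hj : 1 ≤ j ∧ j ≤ n) :
    spectralMass (grid n) (vertex n 1 j ⟨le_rfl, by omega⟩ hj)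
        (vertex n n j ⟨by omega, le_rfl⟩ hj) (horizontalLine n j hj) ≤
      (1 - plaquetteProb 4) ^ ((n + 1) / 3) := by
  classical
  have : Nontrivial (Fin n) := Fin.nontrivial_iff_two_le.2 hn
  obtain ⟨r', hr⟩ :=
    (SimpleGraph.pathGraph_preconnected n).exists_adj_of_nontrivial ⟨j - 1, by omega⟩
  have hl : ∀ i : Fin ((n + 1) / 3), 3 * (i : ℕ) + 1 < n := fun i => by omega
  refine (spectralMass_le_of_plaquettes (grid_preconnected n) card_incidentEdges_grid_le
    (P := fun i => gridPlaquette (hl i) hr) (η := fun i => rightHalf n (3 * i))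
    (fun i i' hii' => ?_) (fun i => ?_)
    fun i e he => bonds_rightHalf_of_mem_horizontalLine hj (hl i) hr he).trans_eq
    (by rw [Fintype.card_fin])
  · rcases lt_or_gt_of_ne hii' with h | h
    · exact disjoint_star_gridPlaquette _ _ (by omega) hr
    · exact (disjoint_star_gridPlaquette _ _ (by omega) hr).symm
  · have hright : ¬ n - 1 ≤ 3 * (i : ℕ) := by have := hl i; omega
    simp [rightHalf, vertex, hright]

end Grid

end EdwardsAnderson

open EdwardsAnderson in
theorem theorem2p2_general :
    ∃ c : ℝ, 0 < c ∧ ∀ (n j : ℕ) (hn : 2 ≤ n) (hj : 1 ≤ j ∧ j ≤ n),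
      spectralMass (grid n) (vertex n 1 j ⟨le_rfl, one_le_two.trans hn⟩ hj)
          (vertex n n j ⟨one_le_two.trans hn, le_rfl⟩ hj) (horizontalLine n j hj) ≤
        ENNReal.ofReal (Real.exp (-(c * n))) := by
  have hpos : 0 < (plaquetteProb 4).toReal := ENNReal.toReal_pos (plaquetteProb_pos 4).ne'
    (ne_top_of_le_ne_top ENNReal.one_ne_top (plaquetteProb_le_one 4))
  refine ⟨(plaquetteProb 4).toReal / 6, by positivity, fun n j hn hj => ?_⟩
  have hcount : (n : ℝ) ≤ 6 * ((n + 1) / 3 : ℕ) := by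
    exact_mod_cast (by omega : n ≤ 6 * ((n + 1) / 3))
  refine ((spectralMass_horizontalLine_le hn hj).trans
    (one_sub_pow_le_ofReal_exp (plaquetteProb_le_one 4) _)).trans ?_
  refine ENNReal.ofReal_le_ofReal (Real.exp_le_exp.2 (neg_le_neg ?_))
  rw [div_mul_eq_mul_div, div_le_iff₀ (by norm_num)]
  nlinarith

theorem theorem2p2 :
    ∃ c : ℝ, 0 < c ∧ ∀ (n : ℕ) (hpos : 0 < n) (heven : Even n),
      EdwardsAnderson.spectralMass (EdwardsAnderson.grid n)
          (EdwardsAnderson.vertex n 1 (n / 2) ⟨le_rfl, hpos⟩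
            (EdwardsAnderson.half_mem hpos heven))
          (EdwardsAnderson.vertex n n (n / 2) ⟨hpos, le_rfl⟩
            (EdwardsAnderson.half_mem hpos heven))
          (EdwardsAnderson.horizontalLine n (n / 2) (EdwardsAnderson.half_mem hpos heven))
        ≤ ENNReal.ofReal (Real.exp (-(c * (n : ℝ)))) :=
  theorem2p2_general.imp fun _ hc => ⟨hc.1, fun n hpos heven =>
    hc.2 n (n / 2) (Nat.le_of_dvd hpos heven.two_dvd) (EdwardsAnderson.half_mem hpos heven)⟩
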